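/- All graphs are finite and simple. For an integer $f\ge 0$, a $K_f$-minor is a graph $G$ whose vertex set is partitioned into $f$ non-empty sets $X_1,\dots,X_f$ such that every induced subgraph $G[X_i]$ is connected and, for all $i\ne j$, $G$ has at least one edge between $X_i$ and $X_j$. A subdivision of a graph $H$ is a graph obtained from $H$ by replacing its edges with internally vertex-disjoint paths (whose internal vertices are new) joining the endpoints of these edges; it is $q$-divisible if each of these paths has length divisible by $q$. **Theorem 1.2.** Let $H$ be a graph with $n$ vertices, $m$ edges and maximum degree at most $3$, and let $q\ge 2$ be an integer. Then there is a least integer $f=f(H,q)\ge 0$ such that every $K_f$-minor contains a $q$-divisible subdivision of $H$ as a subgraph, and $$m(q-1)+n\;\le\; f(H,q)\;\le\; 7mq+8n+14q .$$ Moreover $f(H,q)=\Theta(mq+n)$: there are absolute constants $c,C>0$ such that $c\,(mq+n)\le f(H,q)\le C\,(mq+n)$ for all such $H$ and $q$. -/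

import Mathlib

universe u

/-- `G` is a `K_f`-minor: its vertex set is partitioned into `f` non-empty sets (the supernodes),
each inducing a connected subgraph of `G`, with at least one edge of `G` between any two of them. -/
def IsCompleteMinor {W : Type*} (G : SimpleGraph W) (f : ℕ) : Prop :=
  ∃ X : Fin f → Set W,
    (∀ i, (X i).Nonempty) ∧
    (∀ i j, i ≠ j → Disjoint (X i) (X j)) ∧
    (⋃ i, X i) = Set.univ ∧
    (∀ i, (G.induce (X i)).Connected) ∧
    (∀ i j, i ≠ j → ∃ x ∈ X i, ∃ y ∈ X j, G.Adj x y)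

/-- The set of internal vertices of a walk from `x` to `y`: its vertices other than `x` and `y`. -/
def walkInterior {W : Type*} {G : SimpleGraph W} {x y : W} (p : G.Walk x y) : Set W :=
  {w | w ∈ p.support ∧ w ≠ x ∧ w ≠ y}

/-- A subdivision of `H` contained in `G` as a subgraph, given by its branch vertices and its
subdivision paths. A dart of `H` is an edge with one of its two orientations; the two orientations
of an edge carry the same path, traversed in opposite directions. -/
structure SubdivisionIn {V W : Type*} (H : SimpleGraph V) (G : SimpleGraph W) where
  /-- the branch vertex of a vertex of `H` -/
  branch : V → W
  branch_injective : Function.Injective branch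
  /-- the subdivision path replacing an edge of `H` -/
  path : ∀ d : H.Dart, G.Walk (branch d.fst) (branch d.snd)
  isPath : ∀ d, (path d).IsPath
  path_symm : ∀ d, path d.symm = (path d).reverse
  /-- internal vertices of subdivision paths are not branch vertices -/
  branch_notMem_interior : ∀ d v, branch v ∉ walkInterior (path d)
  /-- the paths replacing distinct edges are internally vertex-disjoint -/
  interior_disjoint : ∀ d d' : H.Dart, d.edge ≠ d'.edge →
    Disjoint (walkInterior (path d)) (walkInterior (path d'))

/-- A subdivision is `q`-divisible if all its subdivision paths have length divisible by `q`. -/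
def SubdivisionIn.IsDivisible {V W : Type*} {H : SimpleGraph V} {G : SimpleGraph W}
    (S : SubdivisionIn H G) (q : ℕ) : Prop :=
  ∀ d : H.Dart, q ∣ (S.path d).length

/-- Every (finite) `K_f`-minor contains a `q`-divisible subdivision of `H`. -/
def ForcesDivisibleSubdivision {V : Type*} (H : SimpleGraph V) (q f : ℕ) : Prop :=
  ∀ (W : Type) [Finite W] (G : SimpleGraph W), IsCompleteMinor G f →
    ∃ S : SubdivisionIn H G, S.IsDivisible q

/-- `f(H, q)`: the least `f` such that every `K_f`-minor contains a `q`-divisible subdivision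
of `H`. -/
noncomputable def divSubdivNumber {V : Type*} (H : SimpleGraph V) (q : ℕ) : ℕ :=
  sInf {f : ℕ | ForcesDivisibleSubdivision H q f}

/-! Lower bound: `K_f` itself is a `K_f`-minor, and each path of a `q`-divisible subdivision has at
least `q - 1` internal vertices.

Upper bound: fix a spanning tree in each supernode and one edge between any two supernodes. A
sequence of distinct supernodes then determines a path, whose length modulo `q` is `pathWeight`.
Inserting one supernode changes the weight by a `detour`. Greedily combining disjoint optional
detours enlarges the set of attainable shifts until it is a whole subgroup `K`, or until all
remaining detours stabilise the set and so lie in a smaller subgroup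
(`IsFlat.exists_adjuster_or_flat`). Iterating gives one adjuster per edge of `H` and a large
leftover set where all detours lie in the same `K`.

In the leftover set, distances between branch vertices modulo `K` depend only on the two vertices,
and are symmetric and additive, hence 2-torsion. As the quotient is cyclic, half of the candidates
are pairwise at distance zero (`IsFlat.exists_half`). Distances between these lie in `K`, and an
adjuster on each edge cancels them exactly. -/

section Weights

/-! ### Weights of supernode sequences and detours -/

variable {ι A : Type*}

/-- The weight of a path through a sequence of supernodes: one for each edge between consecutive
supernodes, and `D b a c` for crossing `b` from `a` to `c`. -/
def pathWeight [AddCommGroupWithOne A] (D : ι → ι → ι → A) : List ι → A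
  | a :: b :: c :: l => 1 + D b a c + pathWeight D (b :: c :: l)
  | [_, _] => 1
  | _ => 0

section
variable [AddCommGroupWithOne A] (D : ι → ι → ι → A)

/-- The two pieces overlap in the edge from `a` to `b`, which is counted twice; hence the `- 1`. Two
common supernodes are needed because a crossing depends on both neighbours. -/
lemma pathWeight_append (l₁ l₂ : List ι) (a b : ι) :
    pathWeight D (l₁ ++ a :: b :: l₂) =
      pathWeight D (l₁ ++ [a, b]) + (pathWeight D (a :: b :: l₂) - 1) := by
  induction l₁ with
  | nil => simp [pathWeight]
  | cons x l ih =>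
    rcases l with _ | ⟨y, l⟩
    · simp only [List.nil_append, List.cons_append, pathWeight]; abel
    · rcases l with _ | ⟨z, l⟩
      · simp only [List.nil_append, List.cons_append, pathWeight]; abel
      · simp only [List.cons_append, pathWeight] at ih ⊢
        rw [ih]; abel

variable {D}

lemma pathWeight_reverse (hD : ∀ i a b, D i a b = D i b a) (l : List ι) :
    pathWeight D l.reverse = pathWeight D l := by
  induction l with
  | nil => rfl
  | cons a l ih =>
    rcases l with _ | ⟨b, l⟩
    · rfl
    rcases l with _ | ⟨c, l⟩
    · rfl
    have h := pathWeight_append D l.reverse [a] c b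
    simp only [List.reverse_cons, List.append_assoc, List.cons_append, List.nil_append] at ih h ⊢
    rw [h, ih]
    simp only [pathWeight, hD b c a]; abel

end

/-- The change of weight of a path through `p, i, j, p'` when `k` is inserted between `i` and
`j`. -/
def detour [AddCommGroupWithOne A] (D : ι → ι → ι → A) (p i k j p' : ι) : A :=
  pathWeight D [p, i, k, j, p'] - pathWeight D [p, i, j, p']

section
variable [AddCommGroupWithOne A] {D : ι → ι → ι → A}

lemma pathWeight_detour (l₁ l₂ : List ι) (p i k j p' : ι) :
    pathWeight D (l₁ ++ p :: i :: k :: j :: p' :: l₂) =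
      pathWeight D (l₁ ++ p :: i :: j :: p' :: l₂) + detour D p i k j p' := by
  rw [pathWeight_append, pathWeight_append D l₁ (j :: p' :: l₂)]
  simp only [pathWeight, detour]; abel

/-- Inserting detours inside `R` changes weights by elements of `K` only. -/
def IsFlat (D : ι → ι → ι → A) (R : Finset ι) (K : AddSubgroup A) : Prop :=
  ∀ p i k j p', [p, i, k, j, p'].Nodup → (∀ x ∈ [p, i, k, j, p'], x ∈ R) → detour D p i k j p' ∈ K

lemma IsFlat.mono {R R' : Finset ι} {K : AddSubgroup A} (h : IsFlat D R K) (hR : R' ⊆ R) :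
    IsFlat D R' K :=
  fun p i k j p' hn hm => h p i k j p' hn fun x hx => hR (hm x hx)

/-- The supernodes of `l` are deleted one by one from the front. The two fixed supernodes at each
end provide the context that a detour requires. -/
lemma IsFlat.pathWeight_sub_mem {R : Finset ι} {K : AddSubgroup A} (h : IsFlat D R K)
    (x a a' y : ι) (l : List ι) (hn : (x :: a :: (l ++ [a', y])).Nodup)
    (hm : ∀ i ∈ x :: a :: (l ++ [a', y]), i ∈ R) :
    pathWeight D (x :: a :: (l ++ [a', y])) - pathWeight D [x, a, a', y] ∈ K := by
  induction l with
  | nil => simp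
  | cons k l ih =>
    obtain ⟨b, c, t, ht⟩ : ∃ b c t, l ++ [a', y] = b :: c :: t := by
      rcases l with _ | ⟨b, _ | ⟨c, l⟩⟩
      · exact ⟨a', y, [], rfl⟩
      · exact ⟨b, a', [y], rfl⟩
      · exact ⟨b, c, l ++ [a', y], rfl⟩
    rw [List.cons_append, ht] at hn hm ⊢
    rw [ht] at ih
    have hsub : List.Sublist (x :: a :: b :: c :: t) (x :: a :: k :: b :: c :: t) := by
      simp
    have hd : detour D x a k b c ∈ K := by
      refine h x a k b c (hn.sublist ?_) fun i hi => hm i ?_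
      · simp
      · simp at hi ⊢; tauto
    have h1 := pathWeight_detour (D := D) [] t x a k b c
    simp only [List.nil_append] at h1
    rw [h1, add_sub_right_comm]
    exact K.add_mem (ih (hn.sublist hsub) fun i hi => hm i (hsub.subset hi)) hd

/-! ### Adjusters -/

/-- Inside `C` one can route a path in such a way that all shifts in `S` of some weight occur,
whatever comes before and after. -/
def Spans (D : ι → ι → ι → A) (C : Finset ι) (S : Finset A) : Prop :=
  ∀ x a a' y, ∃ b, ∀ s ∈ S, ∃ l : List ι, l.Nodup ∧ (∀ i ∈ l, i ∈ C) ∧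
    pathWeight D (x :: a :: (l ++ [a', y])) = b + s

lemma spans_empty : Spans D ∅ {0} := fun x a a' y =>
  ⟨pathWeight D [x, a, a', y], fun s hs => ⟨[], by simp_all⟩⟩

/-- The new supernodes are put in front of the old route, with `k` visited or skipped. The old route
starts in the context `j, p'` either way, so the choice is independent of the shift made later. -/
lemma Spans.extend [DecidableEq ι] [DecidableEq A] {C : Finset ι} {S : Finset A}
    (h : Spans D C S) {p i k j p' : ι} (hn : [p, i, k, j, p'].Nodup)
    (hC : ∀ x ∈ [p, i, k, j, p'], x ∉ C) :
    Spans D (C ∪ [p, i, k, j, p'].toFinset) (S ∪ S.image (· + detour D p i k j p')) := by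
  intro x a a' y
  obtain ⟨b, hb⟩ := h j p' a' y
  have key (l : List ι) : pathWeight D (x :: a :: p :: i :: j :: p' :: (l ++ [a', y])) =
      pathWeight D [x, a, p, i, j, p'] + (pathWeight D (j :: p' :: (l ++ [a', y])) - 1) :=
    pathWeight_append D [x, a, p, i] _ j p'
  refine ⟨pathWeight D [x, a, p, i, j, p'] + (b - 1), fun s hs => ?_⟩
  rw [Finset.mem_union, Finset.mem_image] at hs
  rcases hs with hs | ⟨s, hs, rfl⟩
  · obtain ⟨l, hl, hlC, hw⟩ := hb s hs
    refine ⟨[p, i, j, p'] ++ l, ?_, ?_, ?_⟩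
    · refine List.Nodup.append (hn.sublist (by simp)) hl ?_
      intro z hz hz'
      exact hC z (by simp at hz ⊢; tauto) (hlC z hz')
    · intro z hz
      rw [List.mem_append] at hz
      rcases hz with hz | hz
      · simp at hz ⊢; tauto
      · exact Finset.mem_union_left _ (hlC z hz)
    · have := key l
      simp only [List.cons_append, List.nil_append] at this ⊢
      rw [this, hw]; abel
  · obtain ⟨l, hl, hlC, hw⟩ := hb s hs
    refine ⟨[p, i, k, j, p'] ++ l, ?_, ?_, ?_⟩
    · refine List.Nodup.append hn hl ?_
      intro z hz hz'
      exact hC z hz (hlC z hz')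
    · intro z hz
      rw [List.mem_append] at hz
      rcases hz with hz | hz
      · exact Finset.mem_union_right _ (by simpa using hz)
      · exact Finset.mem_union_left _ (hlC z hz)
    · have h1 := key l
      have h2 := pathWeight_detour (D := D) [x, a] (l ++ [a', y]) p i k j p'
      simp only [List.cons_append, List.nil_append] at h1 h2 ⊢
      rw [h2, h1, hw]; abel

/-- Between any four supernodes of `R`, routing through `C` realises all shifts in `K` of the
direct weight. -/
def IsAdjuster (D : ι → ι → ι → A) (C R : Finset ι) (K : AddSubgroup A) : Prop :=
  ∀ x a a' y, [x, a, a', y].Nodup → (∀ i ∈ [x, a, a', y], i ∈ R) → ∀ z ∈ K,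
    ∃ l : List ι, l.Nodup ∧ (∀ i ∈ l, i ∈ C) ∧
      pathWeight D (x :: a :: (l ++ [a', y])) = pathWeight D [x, a, a', y] + z

lemma IsAdjuster.mono {C R R' : Finset ι} {K K' : AddSubgroup A} (h : IsAdjuster D C R K)
    (hR : R' ⊆ R) (hK : K' ≤ K) : IsAdjuster D C R' K' :=
  fun x a a' y hn hm z hz => h x a a' y hn (fun i hi => hR (hm i hi)) z (hK hz)

/-- By flatness the unknown base weight differs from the direct weight by an element of `K`, and the
shifts fill all of `K`, so this difference is absorbed. -/
lemma Spans.isAdjuster [DecidableEq ι] {C R : Finset ι} {S : Finset A} {K : AddSubgroup A}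
    (h : Spans D C S) (hR : IsFlat D R K) (hC : C ⊆ R) (hS : ∀ s, s ∈ S ↔ s ∈ K) :
    IsAdjuster D C (R \ C) K := by
  intro x a a' y hn hm z hz
  obtain ⟨b, hb⟩ := h x a a' y
  have hbK : b - pathWeight D [x, a, a', y] ∈ K := by
    obtain ⟨l, hl, hlC, hw⟩ := hb 0 ((hS 0).2 K.zero_mem)
    rw [add_zero] at hw
    rw [← hw]
    refine hR.pathWeight_sub_mem x a a' y l ?_ ?_
    · have hm' : ∀ i ∈ [x, a, a', y], i ∉ l := fun i hi hil =>
        (Finset.mem_sdiff.1 (hm i hi)).2 (hlC i hil)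
      simp [List.nodup_append] at hn hm' ⊢
      refine ⟨?_, ?_, hl, ?_, ?_⟩
      · tauto
      · tauto
      · tauto
      · intro c hc
        exact ⟨fun h => hm'.2.2.1 (h ▸ hc), fun h => hm'.2.2.2 (h ▸ hc)⟩
    · intro i hi
      have : i ∈ [x, a, a', y] ∨ i ∈ l := by simp at hi ⊢; tauto
      rcases this with hi | hi
      · exact (Finset.mem_sdiff.1 (hm i hi)).1
      · exact hC (hlC i hi)
  obtain ⟨l, hl, hlC, hw⟩ := hb (z - (b - pathWeight D [x, a, a', y]))
    ((hS _).2 (K.sub_mem hz hbK))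
  exact ⟨l, hl, hlC, by rw [hw]; abel⟩

-- Take a set `S` of shifts of maximal size, subject to five supernodes being spent per element
-- beyond the first. If `S` is not all of `K`, its stabiliser is a proper subgroup of `K`; a detour
-- outside the stabiliser would move some element out of `S` and enlarge it.
open scoped Pointwise in
lemma IsFlat.exists_adjuster_or_flat [Finite A] [DecidableEq ι] {R : Finset ι}
    {K : AddSubgroup A} (hR : IsFlat D R K) :
    ∃ C ⊆ R, C.card + 5 ≤ 5 * Nat.card K ∧
      (IsAdjuster D C (R \ C) K ∨ ∃ K' < K, IsFlat D (R \ C) K') := by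
  classical
  let T : Set ℕ := {n | ∃ (C : Finset ι) (S : Finset A), C ⊆ R ∧ (∀ s ∈ S, s ∈ K) ∧
    0 ∈ S ∧ S.card = n ∧ C.card + 5 ≤ 5 * n ∧ Spans D C S}
  have hcard : ∀ S : Finset A, (∀ s ∈ S, s ∈ K) → S.card ≤ Nat.card K := fun S hS => by
    rw [← Set.ncard_coe_finset]
    exact Set.ncard_le_ncard (t := (K : Set A)) hS (Set.toFinite _)
  have hne : T.Nonempty :=
    ⟨1, ∅, {0}, by simp, by simp [K.zero_mem], by simp, by simp, by simp, spans_empty⟩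
  have hbdd : BddAbove T := ⟨Nat.card K, by rintro n ⟨C, S, -, hS, -, rfl, -⟩; exact hcard S hS⟩
  obtain ⟨C, S, hCR, hSK, h0, hS, hCS, hsp⟩ := Nat.sSup_mem hne hbdd
  refine ⟨C, hCR, hCS.trans (Nat.mul_le_mul_left 5 (hS ▸ hcard S hSK)), ?_⟩
  by_cases hall : ∀ z ∈ K, z ∈ S
  · exact Or.inl (hsp.isAdjuster hR hCR fun s => ⟨hSK s, hall s⟩)
  right
  -- Since `0 ∈ S`, the stabiliser is contained in `S`.
  have hstab : ∀ z ∈ AddAction.stabilizer A S, z ∈ S := fun z hz => by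
    rw [AddAction.mem_stabilizer_iff] at hz
    rw [← hz]
    simpa using Finset.vadd_mem_vadd_finset (a := z) h0
  refine ⟨AddAction.stabilizer A S, lt_of_le_of_ne (fun z hz => hSK z (hstab z hz)) ?_, ?_⟩
  · rintro rfl
    exact hall hstab
  intro p i k j p' hn hm
  by_contra hd
  obtain ⟨s, hs, hsd⟩ : ∃ s ∈ S, s + detour D p i k j p' ∉ S := by
    by_contra! hcon
    refine hd (AddAction.mem_stabilizer_iff.2 (Finset.eq_of_subset_of_card_le ?_ ?_))
    · intro z hz
      obtain ⟨s, hs, rfl⟩ := Finset.mem_vadd_finset.1 hz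
      rw [vadd_eq_add, add_comm]
      exact hcon s hs
    · simp
  have hm' := fun x hx => Finset.mem_sdiff.1 (hm x hx)
  have hlt : S.card + 1 ≤ (S ∪ S.image (· + detour D p i k j p')).card :=
    Finset.card_lt_card (Finset.ssubset_iff_of_subset Finset.subset_union_left |>.2
      ⟨_, Finset.mem_union_right _ (Finset.mem_image_of_mem _ hs), hsd⟩)
  have hmem : (S ∪ S.image (· + detour D p i k j p')).card ∈ T := by
    refine ⟨C ∪ [p, i, k, j, p'].toFinset, _, ?_, ?_, Finset.mem_union_left _ h0, rfl, ?_,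
      hsp.extend hn fun x hx => (hm' x hx).2⟩
    · refine Finset.union_subset hCR fun x hx => (hm' x (List.mem_toFinset.1 hx)).1
    · intro z hz
      rcases Finset.mem_union.1 hz with hz | hz
      · exact hSK z hz
      · obtain ⟨s, hs, rfl⟩ := Finset.mem_image.1 hz
        exact K.add_mem (hSK s hs) (hR p i k j p' hn fun x hx => (hm' x hx).1)
    · have h1 := Finset.card_union_le C [p, i, k, j, p'].toFinset
      have h2 := List.toFinset_card_le [p, i, k, j, p']
      simp only [List.length_cons, List.length_nil] at h2
      omega
  have := le_csSup hbdd hmem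
  omega

/-- A large flat set contains many disjoint adjusters, with a large flat set left over. -/
lemma IsFlat.exists_adjusters [Finite A] [DecidableEq ι] (N t : ℕ) (K : AddSubgroup A)
    (R : Finset ι) (hR : IsFlat D R K)
    (hcard : 5 * Nat.card A * t + 10 * Nat.card K + N ≤ R.card) :
    ∃ (K' : AddSubgroup A) (R' : Finset ι) (C : ℕ → Finset ι), R' ⊆ R ∧ N ≤ R'.card ∧
      IsFlat D R' K' ∧ K' ≤ K ∧ ∀ i < t, C i ⊆ R ∧ Disjoint (C i) R' ∧ IsAdjuster D (C i) R' K' ∧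
        ∀ j < t, i ≠ j → Disjoint (C i) (C j) := by
  induction t generalizing K R with
  | zero => exact ⟨K, R, fun _ => ∅, subset_rfl, by omega, hR, le_rfl, by simp⟩
  | succ t iht =>
    induction hc : Nat.card K using Nat.strong_induction_on generalizing K R with
    | _ c ihc =>
    subst hc
    obtain ⟨C₀, hC₀, hC₀c, h⟩ := hR.exists_adjuster_or_flat
    have hsd := Finset.card_sdiff_add_card_eq_card hC₀
    have hKA : Nat.card K ≤ Nat.card A := Nat.card_le_card_of_injective _ K.subtype_injective
    rw [mul_add, mul_one] at hcard
    rcases h with h | ⟨K', hK', h⟩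
    · obtain ⟨K', R', C, hR', hN, hfl, hKK, hC⟩ :=
        iht K (R \ C₀) (hR.mono Finset.sdiff_subset) (by omega)
      refine ⟨K', R', fun i => if i = t then C₀ else C i, hR'.trans Finset.sdiff_subset, hN, hfl,
        hKK, fun i hi => ?_⟩
      by_cases hit : i = t
      · simp only [hit, if_true]
        refine ⟨hC₀, Finset.disjoint_of_subset_right hR' Finset.disjoint_sdiff, h.mono hR' hKK,
          fun j hj hne => ?_⟩
        rw [if_neg (Ne.symm hne)]
        exact Finset.disjoint_of_subset_right (hC j (by omega)).1 Finset.disjoint_sdiff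
      · simp only [hit, if_false]
        obtain ⟨h1, h2, h3, h4⟩ := hC i (by omega)
        refine ⟨h1.trans Finset.sdiff_subset, h2, h3, fun j hj hne => ?_⟩
        by_cases hjt : j = t
        · simp only [hjt, if_true]
          exact Finset.disjoint_of_subset_left h1 Finset.sdiff_disjoint
        · simp only [hjt, if_false]
          exact h4 j (by omega) hne
    -- No adjuster is gained here, but the order of the subgroup at least halves, so the drop in `10
    -- * Nat.card K` pays for the discarded set of fewer than `5 * Nat.card K` supernodes.
    · have hhalf : 2 * Nat.card K' ≤ Nat.card K := by
        obtain ⟨k, hk⟩ := AddSubgroup.card_dvd_of_le hK'.le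
        have hlt : Nat.card K' < Nat.card K :=
          Set.ncard_lt_ncard (s := (K' : Set A)) (t := K) hK' (Set.toFinite _)
        rcases k with _ | _ | k
        · omega
        · omega
        · rw [hk]; nlinarith [Nat.zero_le (Nat.card K' * k)]
      obtain ⟨K'', R', C, hR', hN, hfl, hKK, hC⟩ := ihc _ (by
        have : 0 < Nat.card K' := Nat.card_pos
        omega) K' (R \ C₀) h (by rw [mul_add, mul_one]; omega) rfl
      refine ⟨K'', R', C, hR'.trans Finset.sdiff_subset, hN, hfl, hKK.trans hK'.le,
        fun i hi => ?_⟩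
      obtain ⟨h1, h2⟩ := hC i hi
      exact ⟨h1.trans Finset.sdiff_subset, h2⟩

/-! ### Distances between branch vertices modulo `K` -/

lemma eq_of_add_self_eq_zero {B : Type*} [AddGroup B] [Finite B] [IsAddCyclic B] {x y : B}
    (hx : x + x = 0) (hy : y + y = 0) (hx0 : x ≠ 0) (hy0 : y ≠ 0) : x = y := by
  classical
  have := Fintype.ofFinite B
  by_contra hxy
  have h := IsAddCyclic.card_nsmul_eq_zero_le (α := B) (n := 2) (by norm_num)
  have h3 : ({0, x, y} : Finset B).card = 3 := by
    rw [Finset.card_eq_three]; exact ⟨0, x, y, hx0.symm, hy0.symm, hxy, rfl⟩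
  have := Finset.card_le_card (s := {0, x, y})
    (t := Finset.univ.filter fun a : B => 2 • a = 0) (by
      intro z hz
      simp only [Finset.mem_insert, Finset.mem_singleton] at hz
      rcases hz with rfl | rfl | rfl <;> simp [two_nsmul, *])
  omega

/-- Each `g` stands for a supernode `e g 0` with a branch vertex at distances `r g` from the exits
towards the supernodes `e g 1, e g 2, e g 3`. For at least half of them, all distances between the
branch vertices vanish modulo `K`. -/
lemma IsFlat.exists_half [Finite A] [IsAddCyclic A] {γ : Type*} [Fintype γ] {R : Finset ι}
    {K : AddSubgroup A} (hR : IsFlat D R K) (hD : ∀ i a b, D i a b = D i b a)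
    (e : γ → Fin 4 → ι) (he : Function.Injective fun p : γ × Fin 4 => e p.1 p.2)
    (heR : ∀ g s, e g s ∈ R) (r : γ → Fin 3 → A)
    (hr : ∀ g s t, s ≠ t → r g s + r g t = D (e g 0) (e g s.succ) (e g t.succ)) :
    ∃ Γ : Finset γ, Fintype.card γ ≤ 2 * Γ.card ∧ ∀ g ∈ Γ, ∀ h ∈ Γ, g ≠ h → ∀ s t,
      r g s + pathWeight D [e g 0, e g s.succ, e h t.succ, e h 0] + r h t ∈ K := by
  classical
  have nodup {l : List (γ × Fin 4)} (hl : l.Nodup) : (l.map fun p => e p.1 p.2).Nodup :=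
    hl.map he
  have memR {l : List (γ × Fin 4)} : ∀ i ∈ l.map (fun p => e p.1 p.2), i ∈ R := by
    intro i hi
    obtain ⟨p, -, rfl⟩ := List.mem_map.1 hi
    exact heR _ _
  let W (g : γ) (s : Fin 3) (h : γ) (t : Fin 3) : A ⧸ K :=
    ((r g s + pathWeight D [e g 0, e g s.succ, e h t.succ, e h 0] + r h t : A) : A ⧸ K)
  have Wsymm (g s h t) : W g s h t = W h t g s := by
    have := pathWeight_reverse hD [e g 0, e g s.succ, e h t.succ, e h 0]
    simp only [List.reverse_cons, List.reverse_nil, List.nil_append, List.cons_append] at this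
    simp only [W, ← this]
    congr 1; abel
  -- Extend the path from `h` through the centre of `g` to a third exit `s''`. Skipping the entry
  -- supernode is a detour, and what remains does not mention it.
  have Wslot (g s s' h t) (hgh : g ≠ h) : W g s h t = W g s' h t := by
    by_cases hss : s = s'
    · rw [hss]
    obtain ⟨s'', h1, h2⟩ : ∃ s'', s'' ≠ s ∧ s'' ≠ s' := by
      revert s s'; decide
    have key (s₁ : Fin 3) (hs₁ : s'' ≠ s₁) : W g s₁ h t = ((r h t - r g s'' +
        pathWeight D [e h 0, e h t.succ, e g 0, e g s''.succ] - 1 : A) : A ⧸ K) := by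
      rw [Wsymm, QuotientAddGroup.eq_iff_sub_mem]
      have := hR (e h 0) (e h t.succ) (e g s₁.succ) (e g 0) (e g s''.succ)
        (nodup (l := [(h, 0), (h, t.succ), (g, s₁.succ), (g, 0), (g, s''.succ)])
          (by simp [hgh.symm, hs₁.symm, (Fin.succ_ne_zero _).symm]))
        (memR (l := [(h, 0), (h, t.succ), (g, s₁.succ), (g, 0), (g, s''.succ)]))
      convert this using 1
      rw [detour]
      simp only [pathWeight, ← hr g s₁ s'' hs₁.symm]
      abel
    rw [key s h1, key s' h2]
  -- Enter `h` and leave it by different exits: the two legs at its branch vertex add up to the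
  -- crossing, and flatness removes the three supernodes of `h` from the path.
  have Wadd (g h l) (hgh : g ≠ h) (hgl : g ≠ l) (hhl : h ≠ l) :
      W g 0 h 0 + W h 0 l 0 = W g 0 l 0 := by
    rw [Wslot h 0 1 l 0 hhl]
    simp only [W]
    rw [← QuotientAddGroup.mk_add, QuotientAddGroup.eq_iff_sub_mem]
    have := hR.pathWeight_sub_mem (e g 0) (e g 1) (e l 1) (e l 0) [e h 1, e h 0, e h 2]
      (nodup (l := [(g, 0), (g, 1), (h, 1), (h, 0), (h, 2), (l, 1), (l, 0)])
          (by simp [hgh, hhl, hgl]))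
      (memR (l := [(g, 0), (g, 1), (h, 1), (h, 0), (h, 2), (l, 1), (l, 0)]))
    convert this using 1
    have h2 := hr h 0 1 (by decide)
    simp only [List.cons_append, List.nil_append, pathWeight]
    change _ = 1 + _ + (1 + _ + (1 + D (e h 0) (e h (Fin.succ 0)) (e h (Fin.succ 1)) + _)) - _
    rw [← h2]
    change r g 0 + (1 + D (e g 1) (e g 0) (e h 1) + (1 + D (e h 1) (e g 1) (e h 0) + 1)) + r h 0 +
      (r h 1 + (1 + D (e h 2) (e h 0) (e l 1) + (1 + D (e l 1) (e h 2) (e l 0) + 1)) + r l 0) -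
      (r g 0 + (1 + D (e g 1) (e g 0) (e l 1) + (1 + D (e l 1) (e g 1) (e l 0) + 1)) + r l 0) = _
    abel
  have Wslots (g h s t) (hgh : g ≠ h) : W g s h t = W g 0 h 0 := by
    rw [Wslot g s 0 h t hgh, Wsymm, Wslot h t 0 g 0 hgh.symm, Wsymm]
  rcases isEmpty_or_nonempty γ with hγ | ⟨⟨g₀⟩⟩
  · exact ⟨∅, by simp⟩
  have := isAddCyclic_of_surjective (QuotientAddGroup.mk' K) (QuotientAddGroup.mk'_surjective K)
  have Wtwo (h l) (hh : h ≠ g₀) (hl : l ≠ g₀) (hhl : h ≠ l) : W g₀ 0 h 0 + W g₀ 0 h 0 = 0 := by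
    have h1 := Wadd g₀ l h hl.symm hh.symm hhl.symm
    have h2 := Wadd g₀ h l hh.symm hl.symm hhl
    have h3 := Wadd h g₀ l hh hhl hl.symm
    rw [Wsymm h 0 g₀ 0] at h3
    rw [← h3, ← add_assoc] at h2
    exact add_eq_right.1 h2
  -- The distance from `g₀` is zero on one class and the unique involution on the other; by
  -- additivity, distances within a class vanish.
  let Γ₁ : Finset γ := Finset.univ.filter fun g => g = g₀ ∨ W g₀ 0 g 0 = 0
  let Γ₂ : Finset γ := Finset.univ.filter fun g => ¬ (g = g₀ ∨ W g₀ 0 g 0 = 0)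
  have hΓ : Γ₁.card + Γ₂.card = Fintype.card γ := Finset.card_filter_add_card_filter_not _
  have good (Γ : Finset γ) (hg : ∀ g ∈ Γ, ∀ h ∈ Γ, g ≠ h → W g 0 h 0 = 0) :
      ∀ g ∈ Γ, ∀ h ∈ Γ, g ≠ h → ∀ s t,
      r g s + pathWeight D [e g 0, e g s.succ, e h t.succ, e h 0] + r h t ∈ K := by
    intro g hg' h hh' hgh s t
    have := hg g hg' h hh' hgh
    rw [← Wslots g h s t hgh] at this
    exact (QuotientAddGroup.eq_zero_iff _).1 this
  rcases le_total Γ₁.card Γ₂.card with hle | hle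
  · refine ⟨Γ₂, by omega, good _ fun g hg h hh hgh => ?_⟩
    simp only [Γ₂, Finset.mem_filter, Finset.mem_univ, true_and, not_or] at hg hh
    have h2 := eq_of_add_self_eq_zero (Wtwo g h hg.1 hh.1 hgh) (Wtwo h g hh.1 hg.1 hgh.symm)
      hg.2 hh.2
    have h3 := Wadd g₀ g h (Ne.symm hg.1) (Ne.symm hh.1) hgh
    rw [h2] at h3
    exact add_eq_left.1 h3
  · refine ⟨Γ₁, by omega, good _ fun g hg h hh hgh => ?_⟩
    simp only [Γ₁, Finset.mem_filter, Finset.mem_univ, true_and] at hg hh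
    by_cases hg0 : g = g₀
    · subst hg0
      exact hh.resolve_left hgh.symm
    by_cases hh0 : h = g₀
    · subst hh0
      rw [Wsymm]
      exact hg.resolve_left hgh
    have h3 := Wadd g₀ g h (Ne.symm hg0) (Ne.symm hh0) hgh
    rwa [hg.resolve_left hg0, hh.resolve_left hh0, zero_add] at h3

end
end Weights

/-! ### Realising weights by paths in the graph -/

section Graphs

open SimpleGraph

variable {W : Type*} {G : SimpleGraph W}

lemma SimpleGraph.Walk.IsPath.append_of_inter {u v w : W} {p : G.Walk u v} {q : G.Walk v w}
    (hp : p.IsPath) (hq : q.IsPath) (h : ∀ x ∈ p.support, x ∈ q.support → x = v) :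
    (p.append q).IsPath := by
  have hq' := hq.support_nodup
  rw [← q.cons_tail_support, List.nodup_cons] at hq'
  refine Walk.IsPath.mk' ?_
  rw [Walk.support_append]
  refine hp.support_nodup.append hq'.2 fun x hx hx' => ?_
  have := h x hx (List.mem_of_mem_tail hx')
  exact hq'.1 (this ▸ hx')

/-- The median is the first vertex at which the path from `x 2` to `x 0` meets the path from `x 0`
to `x 1`. -/
lemma SimpleGraph.IsTree.exists_median (hG : G.IsTree) (x : Fin 3 → W) :
    ∃ (m : W) (P : ∀ s, G.Walk m (x s)), (∀ s, (P s).IsPath) ∧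
      ∀ s t, s ≠ t → ∀ w ∈ (P s).support, w ∈ (P t).support → w = m := by
  classical
  obtain ⟨p, hp, -⟩ := hG.existsUnique_path (x 0) (x 1)
  obtain ⟨q, hq, -⟩ := hG.existsUnique_path (x 2) (x 0)
  obtain ⟨m, hmp, hmq, hm⟩ := q.exists_mem_support_forall_mem_support_imp_eq p.support.toFinset
    ⟨x 0, by simp⟩
  simp only [List.mem_toFinset] at hmp hm
  have hpm : ((p.takeUntil m hmp).append (p.dropUntil m hmp)).IsPath := by
    rwa [Walk.take_spec]
  have h01 : ∀ w ∈ (p.takeUntil m hmp).support, w ∈ (p.dropUntil m hmp).support → w = m := by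
    intro w h1 h2
    by_contra hne
    exact hpm.ne_of_mem_support_of_append hne h1 h2 rfl
  have h02 : ∀ w ∈ (p.takeUntil m hmp).support, w ∈ (q.takeUntil m hmq).support → w = m :=
    fun w h1 h2 => hm w (p.support_takeUntil_subset_support hmp h1) h2
  have h12 : ∀ w ∈ (p.dropUntil m hmp).support, w ∈ (q.takeUntil m hmq).support → w = m :=
    fun w h1 h2 => hm w (p.support_dropUntil_subset_support hmp h1) h2
  refine ⟨m, fun | 0 => (p.takeUntil m hmp).reverse | 1 => p.dropUntil m hmp
                 | 2 => (q.takeUntil m hmq).reverse, ?_, ?_⟩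
  · intro s
    fin_cases s
    · exact (hp.takeUntil hmp).reverse
    · exact hp.dropUntil hmp
    · exact (hq.takeUntil hmq).reverse
  · intro s t hst w
    fin_cases s <;> fin_cases t <;> first | exact absurd rfl hst | skip
    all_goals simp only [Walk.support_reverse, List.mem_reverse]
    · exact h01 w
    · exact h02 w
    · exact fun a b => h01 w b a
    · exact h12 w
    · exact fun a b => h02 w b a
    · exact fun a b => h12 w b a

/-- Distances in a spanning tree of a connected induced subgraph. -/
lemma SimpleGraph.exists_tree_metric {S : Set W} (h : (G.induce S).Connected) :
    ∃ ℓ : W → W → ℕ, (∀ x y, ℓ x y = ℓ y x) ∧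
      (∀ x ∈ S, ∀ y ∈ S, ∃ p : G.Walk x y, p.IsPath ∧ p.length = ℓ x y ∧ ∀ w ∈ p.support, w ∈ S) ∧
      ∀ x : Fin 3 → W, (∀ s, x s ∈ S) → ∃ m ∈ S, ∃ P : ∀ s, G.Walk m (x s),
        (∀ s, (P s).IsPath) ∧ (∀ s, ∀ w ∈ (P s).support, w ∈ S) ∧
        (∀ s t, s ≠ t → ∀ w ∈ (P s).support, w ∈ (P t).support → w = m) ∧
        ∀ s t, s ≠ t → (P s).length + (P t).length = ℓ (x s) (x t) := by
  classical
  obtain ⟨T, hTG, hT⟩ := h.exists_isTree_le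
  let f : T →g G := (Embedding.induce S).toHom.comp (Hom.ofLE hTG)
  have lift {x y : S} (p : T.Walk x y) (hp : p.IsPath) : ∃ p' : G.Walk (x : W) y, p'.IsPath ∧
      p'.length = p.length ∧ ∀ w, w ∈ p'.support ↔ ∃ z ∈ p.support, (z : W) = w :=
    ⟨p.map f, hp.map (f := f) Subtype.val_injective, Walk.length_map f p, fun w => by
      have : (p.map f).support = p.support.map f := Walk.support_map f p
      exact (this ▸ List.mem_map : w ∈ (p.map f).support ↔ _)⟩
  refine ⟨fun x y => if h : x ∈ S ∧ y ∈ S then T.dist ⟨x, h.1⟩ ⟨y, h.2⟩ else 0, ?_, ?_, ?_⟩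
  · intro x y
    by_cases hx : x ∈ S <;> by_cases hy : y ∈ S <;> simp [hx, hy, dist_comm]
  · intro x hx y hy
    obtain ⟨p, hp, hpd⟩ := hT.connected.exists_path_of_dist ⟨x, hx⟩ ⟨y, hy⟩
    obtain ⟨p', hp', hl, hs⟩ := lift p hp
    refine ⟨p', hp', ?_, ?_⟩
    · simp [hl, hpd, hx, hy]
    · intro w hw
      obtain ⟨z, -, rfl⟩ := (hs w).1 hw
      exact z.2
  · intro x hx
    obtain ⟨m, P, hP, hPd⟩ := hT.exists_median fun s => ⟨x s, hx s⟩
    choose P' hP' hl hs using fun s => lift (P s) (hP s)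
    refine ⟨m, m.2, P', hP', ?_, ?_, ?_⟩
    · intro s w hw
      obtain ⟨z, -, rfl⟩ := (hs s w).1 hw
      exact z.2
    · intro s t hst w hw hw'
      obtain ⟨z, hz, rfl⟩ := (hs s w).1 hw
      obtain ⟨z', hz', hzz⟩ := (hs t _).1 hw'
      rw [Subtype.ext hzz] at hz'
      rw [hPd s t hst z hz hz']
    · intro s t hst
      -- Two legs form a path of the tree, and such paths are unique; this makes the lengths add up
      -- exactly, which shortest paths in `G` would not guarantee.
      have hpath : ((P s).reverse.append (P t)).IsPath :=
        (hP s).reverse.append_of_inter (hP t) fun w hw hw' =>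
          hPd s t hst w (by simpa using hw) hw'
      obtain ⟨p, hp, hpd⟩ := hT.connected.exists_path_of_dist ⟨x s, hx s⟩ ⟨x t, hx t⟩
      rw [(hT.existsUnique_path _ _).unique hp hpath] at hpd
      simp only [hl, hx, and_self, dif_pos]
      rw [← hpd]
      simp

/-- A subdivision arises from paths for the darts that stay in disjoint regions assigned to the
edges. -/
lemma exists_subdivision_of_regions {V : Type*} {H : SimpleGraph V} {q : ℕ} (branch : V → W)
    (hb : Function.Injective branch) (reg : Sym2 V → Set W)
    (hreg : ∀ e ∈ H.edgeSet, ∀ e' ∈ H.edgeSet, e ≠ e' → Disjoint (reg e) (reg e'))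
    (hbr : ∀ e ∈ H.edgeSet, ∀ v, branch v ∉ reg e)
    (hp : ∀ d : H.Dart, ∃ p : G.Walk (branch d.fst) (branch d.snd), p.IsPath ∧ q ∣ p.length ∧
      ∀ w ∈ p.support, w = branch d.fst ∨ w = branch d.snd ∨ w ∈ reg d.edge) :
    ∃ S : SubdivisionIn H G, S.IsDivisible q := by
  classical
  choose P hP hq hs using hp
  -- The paths given for the two orientations of an edge may differ. A well-order selects one
  -- orientation, and the other receives the reversed path.
  obtain ⟨r, hr⟩ : ∃ r : V → V → Prop, ∀ a b, a ≠ b → (r a b ↔ ¬ r b a) := by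
    refine ⟨WellOrderingRel, fun a b hab => ⟨fun h h' => asymm h h', fun h => ?_⟩⟩
    rcases trichotomous_of (WellOrderingRel (α := V)) a b with h1 | h1 | h1
    · exact h1
    · exact absurd h1 hab
    · exact absurd h1 h
  obtain ⟨P', hPP', hP'P, hP', hq', hs'⟩ :
      ∃ P' : ∀ d : H.Dart, G.Walk (branch d.fst) (branch d.snd),
      (∀ d, P d.symm = (P' d).reverse) ∧ (∀ d, P' d.symm = (P d).reverse) ∧ (∀ d, (P' d).IsPath) ∧
      (∀ d, q ∣ (P' d).length) ∧
      ∀ d, ∀ w ∈ (P' d).support, w = branch d.fst ∨ w = branch d.snd ∨ w ∈ reg d.edge := by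
    refine ⟨fun d => (P d.symm).reverse, fun d => (Walk.reverse_reverse (P d.symm)).symm,
      fun d => rfl, fun d => (hP d.symm).reverse,
      fun d => (Walk.length_reverse (P d.symm)).symm ▸ hq d.symm, fun d w hw => ?_⟩
    have hw' : w ∈ (P d.symm).support := List.mem_reverse.1
      ((Walk.support_reverse (P d.symm)) ▸ hw : w ∈ (P d.symm).support.reverse)
    have := hs d.symm w hw'
    rw [Dart.edge_symm] at this
    change w = branch d.snd ∨ w = branch d.fst ∨ _ at this
    tauto
  let Q : ∀ d : H.Dart, G.Walk (branch d.fst) (branch d.snd) := fun d =>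
    if r d.fst d.snd then P d else P' d
  have hQ (d : H.Dart) : Q d = P d ∨ Q d = P' d := by
    by_cases h : r d.fst d.snd
    · exact Or.inl (if_pos h)
    · exact Or.inr (if_neg h)
  have hQi (d : H.Dart) : walkInterior (Q d) ⊆ reg d.edge := by
    rintro w ⟨hw, h1, h2⟩
    rcases hQ d with h | h
    · rw [h] at hw
      have := hs d w hw
      tauto
    · rw [h] at hw
      have := hs' d w hw
      tauto
  refine ⟨⟨branch, hb, Q, ?_, ?_, ?_, ?_⟩, ?_⟩
  · intro d
    rcases hQ d with h | h <;> rw [h]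
    · exact hP d
    · exact hP' d
  · intro d
    have hd := hr d.fst d.snd d.fst_ne_snd
    by_cases h : r d.fst d.snd
    · have h' : ¬ r d.symm.fst d.symm.snd := hd.1 h
      have h1 : Q d = P d := if_pos h
      have h2 : Q d.symm = P' d.symm := if_neg h'
      rw [h1, h2]
      exact hP'P d
    · have h' : r d.symm.fst d.symm.snd := by
        by_contra h'; exact h (hd.2 h')
      have h1 : Q d = P' d := if_neg h
      have h2 : Q d.symm = P d.symm := if_pos h'
      rw [h1, h2]
      exact hPP' d
  · exact fun d v hv => hbr _ d.edge_mem v (hQi d hv)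
  · exact fun d d' hne => (hreg _ d.edge_mem _ d'.edge_mem hne).mono (hQi d) (hQi d')
  · intro d
    change q ∣ (Q d).length
    rcases hQ d with h | h <;> rw [h]
    · exact hq d
    · exact hq' d

/-- The attachment vertex in the last supernode of a list, towards the one before it. -/
def lastAttach {ι : Type*} [Inhabited W] (t : ι → ι → W) : List ι → W
  | [a, b] => t b a
  | _ :: b :: c :: l => lastAttach t (b :: c :: l)
  | _ => default

lemma lastAttach_append {ι : Type*} [Inhabited W] (t : ι → ι → W) (l : List ι) (a b : ι) :
    lastAttach t (l ++ [a, b]) = t b a := by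
  induction l with
  | nil => rfl
  | cons x l ih =>
    rcases l with _ | ⟨y, _ | ⟨z, l⟩⟩
    · rfl
    · rfl
    · exact ih

lemma lastAttach_mem {ι : Type*} [Inhabited W] {X : ι → Set W} {t : ι → ι → W}
    (ht : ∀ i j, i ≠ j → t i j ∈ X i) (a b : ι) (l : List ι) (hn : (a :: b :: l).Nodup) :
    ∃ z ∈ b :: l, lastAttach t (a :: b :: l) ∈ X z := by
  induction l generalizing a b with
  | nil => exact ⟨b, by simp, ht b a (by simp at hn; exact Ne.symm hn)⟩
  | cons c l ih =>
    obtain ⟨z, hz, h⟩ := ih b c hn.of_cons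
    exact ⟨z, List.mem_cons_of_mem _ hz, h⟩

/-- A sequence of supernodes can be realised by a path of the prescribed length. -/
lemma exists_path_through {ι A : Type*} [AddCommGroupWithOne A] [Inhabited W] {X : ι → Set W}
    (hX : ∀ i j, i ≠ j → Disjoint (X i) (X j)) {t : ι → ι → W}
    (ht : ∀ i j, i ≠ j → t i j ∈ X i) (hadj : ∀ i j, i ≠ j → G.Adj (t i j) (t j i))
    {D : ι → ι → ι → A} (hD : ∀ i a b, i ≠ a → i ≠ b → ∃ p : G.Walk (t i a) (t i b), p.IsPath ∧
      (p.length : A) = D i a b ∧ ∀ w ∈ p.support, w ∈ X i)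
    (a b : ι) (l : List ι) (hn : (a :: b :: l).Nodup) :
    ∃ p : G.Walk (t a b) (lastAttach t (a :: b :: l)), p.IsPath ∧
      (p.length : A) = pathWeight D (a :: b :: l) ∧
      ∀ w ∈ p.support, w = t a b ∨ w = lastAttach t (a :: b :: l) ∨
        ∃ i ∈ (b :: l).dropLast, w ∈ X i := by
  have hXe : ∀ {i j w}, w ∈ X i → w ∈ X j → i = j := fun {i j w} h1 h2 => by
    by_contra hne
    exact Set.disjoint_left.1 (hX i j hne) h1 h2
  induction l generalizing a b with
  | nil =>
    have hab : a ≠ b := by simpa using hn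
    have h : G.Adj (t a b) (lastAttach t [a, b]) := hadj a b hab
    refine ⟨h.toWalk, h.isPath_toWalk, by simp [pathWeight, Adj.toWalk], ?_⟩
    intro w hw
    simp [Adj.toWalk] at hw ⊢
    tauto
  | cons c l ih =>
    obtain ⟨p, hp, hpl, hps⟩ := ih b c hn.of_cons
    have hab : a ≠ b := by rintro rfl; simp at hn
    have hbc : b ≠ c := by rintro rfl; simp at hn
    obtain ⟨r, hr, hrl, hrs⟩ := hD b a c hab.symm hbc
    obtain ⟨z, hz, hlast⟩ := lastAttach_mem ht b c l hn.of_cons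
    have hbz : b ≠ z := by
      rintro rfl; exact (List.nodup_cons.1 hn.of_cons).1 hz
    have haz : a ≠ z := by
      rintro rfl; exact (List.nodup_cons.1 hn).1 (List.mem_cons_of_mem _ hz)
    obtain ⟨rp, hrp, hrpl, hrps⟩ : ∃ rp : G.Walk (t b a) (lastAttach t (a :: b :: c :: l)),
        rp.IsPath ∧ rp.length = r.length + p.length ∧
        ∀ w, w ∈ rp.support ↔ w ∈ r.support ∨ w ∈ p.support := by
      refine ⟨r.append p, ?_, Walk.length_append r p, fun w => Walk.mem_support_append_iff r p⟩
      refine hr.append_of_inter hp fun w hw hw' => ?_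
      rcases hps w hw' with h | h | ⟨i, hi, h⟩
      · exact h
      · rw [h] at hw
        exact absurd (hXe (hrs _ hw) hlast) hbz
      · refine absurd (hXe (hrs _ hw) h) ?_
        rintro rfl
        exact (List.nodup_cons.1 hn.of_cons).1 (List.mem_of_mem_dropLast hi)
    have hsup : ∀ w ∈ rp.support, w = lastAttach t (a :: b :: c :: l) ∨
        ∃ i ∈ (b :: c :: l).dropLast, w ∈ X i := by
      intro w hw
      rw [hrps] at hw
      rcases hw with hw | hw
      · exact Or.inr ⟨b, by simp, hrs w hw⟩
      · rcases hps w hw with h | h | ⟨i, hi, h⟩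
        · exact Or.inr ⟨b, by simp, h ▸ ht b c hbc⟩
        · exact Or.inl h
        · exact Or.inr ⟨i, by simp at hi ⊢; tauto, h⟩
    refine ⟨Walk.cons (hadj a b hab) rp, hrp.cons fun hw => ?_, ?_, ?_⟩
    · rcases hsup _ hw with h | ⟨i, hi, h⟩
      · exact haz (hXe (ht a b hab) (h ▸ hlast))
      · have := hXe (ht a b hab) h
        subst this
        exact (List.nodup_cons.1 hn).1 (List.mem_of_mem_dropLast hi)
    · rw [Walk.length_cons, hrpl]
      push_cast
      rw [hrl, hpl, pathWeight]; abel
    · intro w hw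
      rw [Walk.support_cons, List.mem_cons] at hw
      rcases hw with hw | hw
      · exact Or.inl hw
      · exact Or.inr (hsup w hw)

end Graphs

/-! ### Lower and upper bounds for `f(H, q)` -/

section Bounds

open SimpleGraph

/-- The general upper bound has a term `10 * q`, which is not `O(mq + n)` when there are no edges;
this case is therefore treated separately. -/
lemma forcesDivisibleSubdivision_of_isEmpty_dart {V : Type*} [Fintype V] (H : SimpleGraph V)
    [IsEmpty H.Dart] (q : ℕ) : ForcesDivisibleSubdivision H q (Fintype.card V) := by
  rintro W _ G ⟨X, hne, hdis, -, -, -⟩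
  choose x hx using hne
  refine exists_subdivision_of_regions (fun v => x (Fintype.equivFin V v)) ?_ (fun _ => ∅) (by simp)
    (by simp) isEmptyElim
  intro v w hvw
  by_contra hne
  refine Set.disjoint_left.1 (hdis _ _ ((Fintype.equivFin V).injective.ne hne)) (hx _) ?_
  dsimp only at hvw
  rw [hvw]
  exact hx _

lemma isCompleteMinor_top (f : ℕ) : IsCompleteMinor (⊤ : SimpleGraph (Fin f)) f := by
  refine ⟨fun i => {i}, by simp, by simp, by ext; simp, fun i => ?_, by simp⟩
  exact Connected.of_subsingleton

lemma ForcesDivisibleSubdivision.le {V : Type*} [Fintype V] (H : SimpleGraph V)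
    [Fintype H.edgeSet] {q f : ℕ} (h : ForcesDivisibleSubdivision H q f) :
    H.edgeFinset.card * (q - 1) + Fintype.card V ≤ f := by
  classical
  obtain ⟨S, hS⟩ := h (Fin f) ⊤ (isCompleteMinor_top f)
  have hd : ∀ e : H.edgeSet, ∃ d : H.Dart, d.edge = e := by
    rintro ⟨e, he⟩
    induction e with
    | _ a b => exact ⟨⟨(a, b), he⟩, rfl⟩
  choose d hd using hd
  let I (e : H.edgeSet) : Finset (Fin f) := Finset.univ.filter (· ∈ walkInterior (S.path (d e)))
  have hI (e : H.edgeSet) : q - 1 ≤ (I e).card := by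
    have hne : S.branch (d e).fst ≠ S.branch (d e).snd := S.branch_injective.ne (d e).fst_ne_snd
    have hpos : 0 < (S.path (d e)).length := by
      rw [Nat.pos_iff_ne_zero]
      exact fun h0 => hne (Walk.eq_of_length_eq_zero h0)
    have hq := Nat.le_of_dvd hpos (hS (d e))
    have hcard := List.toFinset_card_of_nodup (S.isPath (d e)).support_nodup
    rw [Walk.length_support] at hcard
    have hsub : (S.path (d e)).support.toFinset ⊆
        insert (S.branch (d e).fst) (insert (S.branch (d e).snd) (I e)) := by
      intro w hw
      by_cases h1 : w = S.branch (d e).fst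
      · simp [h1]
      by_cases h2 : w = S.branch (d e).snd
      · simp [h2]
      refine Finset.mem_insert_of_mem (Finset.mem_insert_of_mem (Finset.mem_filter.2 ?_))
      exact ⟨Finset.mem_univ w, List.mem_toFinset.1 hw, h1, h2⟩
    have h1 := Finset.card_le_card hsub
    have h2 := Finset.card_insert_le (S.branch (d e).fst) (insert (S.branch (d e).snd) (I e))
    have h3 := Finset.card_insert_le (S.branch (d e).snd) (I e)
    omega
  have hdisj : Disjoint (Finset.univ.biUnion I) (Finset.univ.image S.branch) := by
    rw [Finset.disjoint_left]
    intro w hw hw'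
    obtain ⟨e, -, he⟩ := Finset.mem_biUnion.1 hw
    obtain ⟨v, -, rfl⟩ := Finset.mem_image.1 hw'
    exact S.branch_notMem_interior (d e) v (Finset.mem_filter.1 he).2
  have hcard := Finset.card_le_univ (Finset.univ.biUnion I ∪ Finset.univ.image S.branch)
  rw [Finset.card_union_of_disjoint hdisj, Finset.card_image_of_injective _ S.branch_injective,
    Finset.card_univ, Fintype.card_fin, Finset.card_biUnion] at hcard
  · have h1 := Finset.card_nsmul_le_sum Finset.univ (fun e => (I e).card) (q - 1)
      fun e _ => hI e
    rw [Finset.card_univ, smul_eq_mul] at h1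
    have h2 : Fintype.card H.edgeSet = H.edgeFinset.card := by
      rw [edgeFinset, Set.toFinset_card]
    rw [← h2]
    omega
  · intro e _ e' _ hee
    refine Finset.disjoint_left.2 fun w hw hw' => ?_
    refine Set.disjoint_left.1 (S.interior_disjoint (d e) (d e') ?_) (Finset.mem_filter.1 hw).2
      (Finset.mem_filter.1 hw').2
    rw [hd, hd]
    exact fun h => hee (Subtype.ext h)

/-- Distributes the exits of a branch vertex among its incident edges; for `k = 3` these are the
legs at a median. -/
lemma exists_slots {V : Type*} [Fintype V] [DecidableEq V] (H : SimpleGraph V)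
    [DecidableRel H.Adj] {k : ℕ} (hk : 0 < k) (hH : H.maxDegree ≤ k) :
    ∃ σ : V → Sym2 V → Fin k, ∀ v, ∀ e ∈ H.edgeSet, ∀ e' ∈ H.edgeSet, v ∈ e → v ∈ e' →
      σ v e = σ v e' → e = e' := by
  have (v : V) : Nonempty ({e // e ∈ H.incidenceFinset v} ↪ Fin k) :=
    Function.Embedding.nonempty_of_card_le (by
      rw [Fintype.card_coe, Fintype.card_fin, card_incidenceFinset_eq_degree]
      exact (H.degree_le_maxDegree v).trans hH)
  have emb := fun v => (this v).some
  refine ⟨fun v e => if h : e ∈ H.incidenceFinset v then emb v ⟨e, h⟩ else ⟨0, hk⟩, ?_⟩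
  intro v e he e' he' hv hv' heq
  have h : e ∈ H.incidenceFinset v := by simp [incidenceSet, he, hv]
  have h' : e' ∈ H.incidenceFinset v := by simp [incidenceSet, he', hv']
  simp only [h, h', dif_pos] at heq
  exact congrArg Subtype.val ((emb v).injective heq)

lemma exists_attachments {W ι : Type*} [Inhabited W] [LinearOrder ι] {G : SimpleGraph W}
    {X : ι → Set W} (hadj : ∀ i j, i ≠ j → ∃ x ∈ X i, ∃ y ∈ X j, G.Adj x y) :
    ∃ t : ι → ι → W, (∀ i j, i ≠ j → t i j ∈ X i) ∧ ∀ i j, i ≠ j → G.Adj (t i j) (t j i) := by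
  choose! x hx y hy hxy using hadj
  refine ⟨fun i j => if i < j then x i j else y j i, ?_, ?_⟩
  · intro i j hij
    dsimp only
    split_ifs
    · exact hx i j hij
    · exact hy j i hij.symm
  · intro i j hij
    rcases lt_or_gt_of_ne hij with h | h
    · simpa [h, h.not_gt] using hxy i j hij
    · simpa [h, h.not_gt] using (hxy j i hij.symm).symm

lemma forcesDivisibleSubdivision_of_maxDegree_le_three {V : Type*} [Fintype V] [DecidableEq V]
    (H : SimpleGraph V) [DecidableRel H.Adj] (hH : H.maxDegree ≤ 3) (q : ℕ) (hq : 0 < q) :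
    ForcesDivisibleSubdivision H q
      (5 * q * H.edgeFinset.card + 10 * q + 8 * Fintype.card V) := by
  classical
  set f := 5 * q * H.edgeFinset.card + 10 * q + 8 * Fintype.card V
  rintro W _ G ⟨X, hne, hdis, -, hconn, hadj⟩
  have : NeZero q := ⟨hq.ne'⟩
  have : Inhabited W := ⟨(hne ⟨0, by omega⟩).some⟩
  have hXe : ∀ {i j w}, w ∈ X i → w ∈ X j → i = j := fun {i j w} h1 h2 => by
    by_contra hne
    exact Set.disjoint_left.1 (hdis i j hne) h1 h2
  choose ℓ hsymm hpath hmed using fun i => exists_tree_metric (hconn i)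
  obtain ⟨t, ht, htadj⟩ := exists_attachments hadj
  let D : Fin f → Fin f → Fin f → ZMod q := fun i a b => (ℓ i (t i a) (t i b) : ZMod q)
  -- Every set is flat for the whole of `ZMod q`, so `5 * q` supernodes per edge and `10 * q` more
  -- suffice. The `8n` left over hold `2n` candidates of four supernodes each, half of which
  -- survive.
  obtain ⟨K, R, C, -, hRcard, hflat, -, hC⟩ :=
    IsFlat.exists_adjusters (D := D) (8 * Fintype.card V) H.edgeFinset.card ⊤ Finset.univ
      (fun _ _ _ _ _ _ _ => AddSubgroup.mem_top _) (by simp [f])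
  obtain ⟨E₀⟩ : Nonempty (Fin (2 * Fintype.card V) × Fin 4 ↪ R) :=
    Function.Embedding.nonempty_of_card_le (by simp; omega)
  let E : Fin (2 * Fintype.card V) → Fin 4 → Fin f := fun g s => E₀ (g, s)
  have hER (g s) : E g s ∈ R := (E₀ (g, s)).2
  have hE : Function.Injective fun p : Fin (2 * Fintype.card V) × Fin 4 => E p.1 p.2 :=
    Subtype.val_injective.comp E₀.injective
  have hE' {g s g' s'} (h : E g s = E g' s') : g = g' ∧ s = s' :=
    Prod.ext_iff.1 (hE (a₁ := (g, s)) (a₂ := (g', s')) h)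
  have hE0 (g : Fin (2 * Fintype.card V)) (s : Fin 3) : E g 0 ≠ E g s.succ := fun h =>
    (Fin.succ_ne_zero s).symm (hE' h).2
  have hmed' : ∀ g, ∃ m ∈ X (E g 0), ∃ P : ∀ s : Fin 3, G.Walk m (t (E g 0) (E g s.succ)),
        (∀ s, (P s).IsPath) ∧ (∀ s, ∀ w ∈ (P s).support, w ∈ X (E g 0)) ∧
        (∀ s t, s ≠ t → ∀ w ∈ (P s).support, w ∈ (P t).support → w = m) ∧
        ∀ s s', s ≠ s' → (P s).length + (P s').length =
          ℓ (E g 0) (t (E g 0) (E g s.succ)) (t (E g 0) (E g s'.succ)) :=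
    fun g => hmed (E g 0) (fun s => t (E g 0) (E g s.succ)) fun s => ht _ _ (hE0 g s)
  choose b hb P hP hPX hPd hPl using hmed'
  obtain ⟨Γ, hΓ, hΓK⟩ := hflat.exists_half (fun i a b => by simp only [D, hsymm]) E hE hER
    (fun g s => ((P g s).length : ZMod q)) (fun g s s' h => by
      simp only [D, ← hPl g s s' h, Nat.cast_add])
  obtain ⟨φ₀⟩ : Nonempty (V ↪ Γ) := Function.Embedding.nonempty_of_card_le (by
    rw [Fintype.card_fin] at hΓ; rw [Fintype.card_coe]; omega)
  let φ : V → Fin (2 * Fintype.card V) := fun v => φ₀ v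
  have hφ : Function.Injective φ := Subtype.val_injective.comp φ₀.injective
  have hφΓ (v) : φ v ∈ Γ := (φ₀ v).2
  obtain ⟨σ, hσ⟩ := exists_slots H (by norm_num) hH
  obtain ⟨idx, hidx, hidx_inj⟩ : ∃ idx : Sym2 V → ℕ,
      (∀ e ∈ H.edgeSet, idx e < H.edgeFinset.card) ∧
      ∀ e ∈ H.edgeSet, ∀ e' ∈ H.edgeSet, idx e = idx e' → e = e' := by
    refine ⟨fun e => if h : e ∈ H.edgeFinset then H.edgeFinset.equivFin ⟨e, h⟩ else 0, ?_, ?_⟩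
    · intro e he
      simp [mem_edgeFinset.2 he]
    · intro e he e' he' h
      simp only [mem_edgeFinset.2 he, mem_edgeFinset.2 he', dif_pos] at h
      exact congrArg Subtype.val (H.edgeFinset.equivFin.injective (Fin.ext h))
  have hCR {e} (he : e ∈ H.edgeSet) {i g s} (hi : i ∈ C (idx e)) (h : i = E g s) : False :=
    Finset.disjoint_left.1 (hC _ (hidx e he)).2.1 hi (h ▸ hER g s)
  -- The region of an edge consists of its adjuster and, at each end, its exit supernode and its leg
  -- without the branch vertex.
  refine exists_subdivision_of_regions (fun v => b (φ v)) ?_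
    (fun e => {w | (∃ i ∈ C (idx e), w ∈ X i) ∨ ∃ v ∈ e, w ∈ X (E (φ v) (σ v e).succ) ∨
      (w ∈ (P (φ v) (σ v e)).support ∧ w ≠ b (φ v))}) ?_ ?_ ?_
  · intro v w hvw
    have h1 := hb (φ v)
    dsimp only at hvw
    rw [hvw] at h1
    exact hφ (hE' (hXe h1 (hb (φ w)))).1
  · intro e he e' he' hee
    rw [Set.disjoint_left]
    rintro w (⟨i, hi, hw⟩ | ⟨v, hv, hw | ⟨hw, hwb⟩⟩)
      (⟨i', hi', hw'⟩ | ⟨v', hv', hw' | ⟨hw', hwb'⟩⟩)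
    · have := hXe hw hw'
      subst this
      exact Finset.disjoint_left.1 ((hC _ (hidx e he)).2.2.2 _ (hidx e' he')
        fun h => hee (hidx_inj e he e' he' h)) hi hi'
    · exact hCR he hi (hXe hw hw')
    · exact hCR he hi (hXe hw (hPX _ _ _ hw'))
    · exact hCR he' hi' (hXe hw' hw)
    · obtain ⟨h1, h2⟩ := hE' (hXe hw hw')
      have h3 := hφ h1
      subst h3
      exact hee (hσ v e he e' he' hv hv' (Fin.succ_injective _ h2))
    · exact Fin.succ_ne_zero _ (hE' (hXe hw (hPX _ _ _ hw'))).2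
    · exact hCR he' hi' (hXe hw' (hPX _ _ _ hw))
    · exact Fin.succ_ne_zero _ (hE' (hXe hw' (hPX _ _ _ hw))).2
    · obtain ⟨h1, -⟩ := hE' (hXe (hPX _ _ _ hw) (hPX _ _ _ hw'))
      have h3 := hφ h1
      subst h3
      exact hwb (hPd _ _ _ (fun h => hee (hσ v e he e' he' hv hv' h)) w hw hw')
  · rintro e he v (⟨i, hi, hw⟩ | ⟨v', hv', hw | ⟨hw, hwb⟩⟩)
    · exact hCR he hi (hXe hw (hb _))
    · exact Fin.succ_ne_zero _ (hE' (hXe hw (hb _))).2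
    · obtain ⟨h1, -⟩ := hE' (hXe (hb (φ v)) (hPX _ _ _ hw))
      rw [h1] at hwb
      exact hwb rfl
  · intro d
    obtain ⟨v, hv⟩ : ∃ v, v = d.fst := ⟨_, rfl⟩
    obtain ⟨w, hw⟩ : ∃ w, w = d.snd := ⟨_, rfl⟩
    obtain ⟨e, he⟩ : ∃ e, e = d.edge := ⟨_, rfl⟩
    have heH : e ∈ H.edgeSet := he ▸ d.edge_mem
    have hve : v ∈ e := by rw [he, hv]; exact Sym2.mem_mk_left _ _
    have hwe : w ∈ e := by rw [he, hw]; exact Sym2.mem_mk_right _ _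
    have hvw : φ v ≠ φ w := hφ.ne (by rw [hv, hw]; exact d.fst_ne_snd)
    rw [← hv, ← hw, ← he]
    have hnd : [E (φ v) 0, E (φ v) (σ v e).succ, E (φ w) (σ w e).succ, E (φ w) 0].Nodup :=
      (List.Nodup.map hE (l := [(φ v, 0), (φ v, (σ v e).succ), (φ w, (σ w e).succ), (φ w, 0)])
        (by simp [hvw, (Fin.succ_ne_zero _).symm]))
    -- The direct connection including both legs has its length in `K`; the adjuster shifts it by
    -- the negative, making the total zero modulo `q`.
    obtain ⟨l, hl, hlC, hlw⟩ := (hC _ (hidx e heH)).2.2.1 _ _ _ _ hnd (by simp [hER]) _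
      (K.neg_mem (hΓK _ (hφΓ v) _ (hφΓ w) hvw (σ v e) (σ w e)))
    have hlE (g s) : E g s ∉ l := fun h => hCR heH (hlC _ h) rfl
    have hnd' : (E (φ v) 0 :: E (φ v) (σ v e).succ ::
        (l ++ [E (φ w) (σ w e).succ, E (φ w) 0])).Nodup := by
      simp [List.nodup_append] at hnd ⊢
      refine ⟨⟨hnd.1.1, hlE _ _, hnd.1.2⟩, ⟨hlE _ _, hnd.2.1⟩, hl, hnd.2.2, fun a ha => ⟨?_, ?_⟩⟩
      · rintro rfl; exact hlE _ _ ha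
      · rintro rfl; exact hlE _ _ ha
    have hthrough := exists_path_through hdis ht htadj (D := D)
      (fun i x y hx hy => by
        obtain ⟨p, hp, hpl, hps⟩ := hpath i (t i x) (ht i x hx) (t i y) (ht i y hy)
        exact ⟨p, hp, by rw [hpl], hps⟩) _ _ _ hnd'
    rw [show lastAttach t (E (φ v) 0 :: E (φ v) (σ v e).succ ::
        (l ++ [E (φ w) (σ w e).succ, E (φ w) 0])) = t (E (φ w) 0) (E (φ w) (σ w e).succ) from
        lastAttach_append t (E (φ v) 0 :: E (φ v) (σ v e).succ :: l) _ _] at hthrough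
    obtain ⟨p, hp, hpl, hps⟩ := hthrough
    have hps' : ∀ x ∈ p.support, x = t (E (φ v) 0) (E (φ v) (σ v e).succ) ∨
        x = t (E (φ w) 0) (E (φ w) (σ w e).succ) ∨ x ∈ X (E (φ v) (σ v e).succ) ∨
        x ∈ X (E (φ w) (σ w e).succ) ∨ ∃ i ∈ l, x ∈ X i := by
      intro x hx
      rcases hps x hx with h | h | ⟨i, hi, h⟩
      · exact Or.inl h
      · exact Or.inr (Or.inl h)
      · have : i = E (φ v) (σ v e).succ ∨ i = E (φ w) (σ w e).succ ∨ i ∈ l := by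
          rw [show E (φ v) (σ v e).succ :: (l ++ [E (φ w) (σ w e).succ, E (φ w) 0]) =
            (E (φ v) (σ v e).succ :: (l ++ [E (φ w) (σ w e).succ])) ++ [E (φ w) 0] by simp,
            List.dropLast_concat] at hi
          simp at hi
          tauto
        rcases this with rfl | rfl | hil
        · exact Or.inr (Or.inr (Or.inl h))
        · exact Or.inr (Or.inr (Or.inr (Or.inl h)))
        · exact Or.inr (Or.inr (Or.inr (Or.inr ⟨i, hil, h⟩)))
    have htX (v' : V) : t (E (φ v') 0) (E (φ v') (σ v' e).succ) ∈ X (E (φ v') 0) :=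
      ht _ _ (hE0 _ _)
    have hne0 : E (φ v) 0 ≠ E (φ w) 0 := fun h => hvw (hE' h).1
    have hp2 : (p.append (P (φ w) (σ w e)).reverse).IsPath := by
      refine hp.append_of_inter (hP _ _).reverse fun x hx hx' => ?_
      rw [Walk.support_reverse, List.mem_reverse] at hx'
      have hxX := hPX _ _ _ hx'
      rcases hps' x hx with h | h | h | h | ⟨i, hi, h⟩
      · rw [h] at hxX
        exact absurd (hXe (htX v) hxX) hne0
      · exact h
      · exact absurd (hE' (hXe h hxX)).2 (Fin.succ_ne_zero _)
      · exact absurd (hE' (hXe h hxX)).2 (Fin.succ_ne_zero _)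
      · exact absurd (hXe h hxX) fun h => hlE _ _ (h ▸ hi)
    refine ⟨(P (φ v) (σ v e)).append (p.append (P (φ w) (σ w e)).reverse), ?_, ?_, ?_⟩
    · refine (hP _ _).append_of_inter hp2 fun x hx hx' => ?_
      have hxX := hPX _ _ _ hx
      rw [Walk.mem_support_append_iff, Walk.support_reverse, List.mem_reverse] at hx'
      rcases hx' with hx' | hx'
      · rcases hps' x hx' with h | h | h | h | ⟨i, hi, h⟩
        · exact h
        · rw [h] at hxX
          exact absurd (hXe hxX (htX w)) hne0
        · exact absurd (hE' (hXe h hxX)).2 (Fin.succ_ne_zero _)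
        · exact absurd (hE' (hXe h hxX)).2 (Fin.succ_ne_zero _)
        · exact absurd (hXe h hxX) fun h => hlE _ _ (h ▸ hi)
      · exact absurd (hXe hxX (hPX _ _ _ hx')) hne0
    · rw [← ZMod.natCast_eq_zero_iff, Walk.length_append, Walk.length_append, Walk.length_reverse]
      push_cast
      rw [hpl, hlw]
      abel
    · intro x hx
      have hend (v' : V) (hv' : v' ∈ e) (hx : x ∈ (P (φ v') (σ v' e)).support) :
          x = b (φ v') ∨ ∃ v ∈ e, x ∈ X (E (φ v) (σ v e).succ) ∨
            (x ∈ (P (φ v) (σ v e)).support ∧ x ≠ b (φ v)) := by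
        by_cases h : x = b (φ v')
        · exact Or.inl h
        · exact Or.inr ⟨v', hv', Or.inr ⟨hx, h⟩⟩
      rw [Walk.mem_support_append_iff, Walk.mem_support_append_iff, Walk.support_reverse,
        List.mem_reverse] at hx
      obtain h | h | h | ⟨v', hv', h⟩ : x ∈ (P (φ v) (σ v e)).support ∨
          x ∈ (P (φ w) (σ w e)).support ∨ (∃ i ∈ C (idx e), x ∈ X i) ∨
          ∃ v' ∈ e, x ∈ X (E (φ v') (σ v' e).succ) := by
        rcases hx with hx | hx | hx
        · exact Or.inl hx
        · rcases hps' x hx with h | h | h | h | ⟨i, hi, h⟩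
          · exact Or.inl (by rw [h]; exact Walk.end_mem_support _)
          · exact Or.inr (Or.inl (by rw [h]; exact Walk.end_mem_support _))
          · exact Or.inr (Or.inr (Or.inr ⟨v, hve, h⟩))
          · exact Or.inr (Or.inr (Or.inr ⟨w, hwe, h⟩))
          · exact Or.inr (Or.inr (Or.inl ⟨i, hlC i hi, h⟩))
        · exact Or.inr (Or.inl hx)
      · rcases hend v hve h with h | h
        · exact Or.inl h
        · exact Or.inr (Or.inr (Or.inr h))
      · rcases hend w hwe h with h | h
        · exact Or.inr (Or.inl h)
        · exact Or.inr (Or.inr (Or.inr h))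
      · exact Or.inr (Or.inr (Or.inl h))
      · exact Or.inr (Or.inr (Or.inr ⟨v', hv', Or.inl h⟩))

lemma divSubdivNumber_bounds {V : Type*} [Fintype V] [DecidableEq V] (H : SimpleGraph V)
    [DecidableRel H.Adj] (hH : H.maxDegree ≤ 3) (q : ℕ) (hq : 0 < q) :
    IsLeast {f : ℕ | ForcesDivisibleSubdivision H q f} (divSubdivNumber H q) ∧
      H.edgeFinset.card * (q - 1) + Fintype.card V ≤ divSubdivNumber H q ∧
      divSubdivNumber H q ≤ 5 * q * H.edgeFinset.card + 10 * q + 8 * Fintype.card V ∧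
      (H.edgeFinset.card = 0 → divSubdivNumber H q ≤ Fintype.card V) := by
  have hup := forcesDivisibleSubdivision_of_maxDegree_le_three H hH q hq
  have hmem : ForcesDivisibleSubdivision H q (divSubdivNumber H q) :=
    Nat.sInf_mem (s := {f : ℕ | ForcesDivisibleSubdivision H q f}) ⟨_, hup⟩
  refine ⟨⟨hmem, fun f hf => Nat.sInf_le hf⟩, hmem.le, Nat.sInf_le hup, fun h0 => ?_⟩
  have : IsEmpty H.Dart := ⟨fun d => by
    rw [Finset.card_eq_zero] at h0
    have := mem_edgeFinset.2 d.edge_mem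
    rw [h0] at this
    exact Finset.notMem_empty _ this⟩
  exact Nat.sInf_le (forcesDivisibleSubdivision_of_isEmpty_dart H q)

end Bounds

theorem theorem1p2 :
    (∀ (V : Type u) [Fintype V] [DecidableEq V] (H : SimpleGraph V) [DecidableRel H.Adj]
        (n m q : ℕ), Fintype.card V = n → H.edgeFinset.card = m → H.maxDegree ≤ 3 → 2 ≤ q →
      IsLeast {f : ℕ | ForcesDivisibleSubdivision H q f} (divSubdivNumber H q) ∧
        m * (q - 1) + n ≤ divSubdivNumber H q ∧
        divSubdivNumber H q ≤ 7 * m * q + 8 * n + 14 * q) ∧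
    (∃ c C : ℝ, 0 < c ∧ 0 < C ∧
      ∀ (V : Type u) [Fintype V] [DecidableEq V] (H : SimpleGraph V) [DecidableRel H.Adj]
        (n m q : ℕ), Fintype.card V = n → H.edgeFinset.card = m → H.maxDegree ≤ 3 → 2 ≤ q →
      c * ((m : ℝ) * q + n) ≤ divSubdivNumber H q ∧
        (divSubdivNumber H q : ℝ) ≤ C * ((m : ℝ) * q + n)) := by

  -- `1 / 2` works because `q - 1 ≥ q / 2`; `15 = 5 + 10` because `10 * q ≤ 10 * m * q` once `m ≥
  -- 1`.
  refine ⟨?_, 1 / 2, 15, by norm_num, by norm_num, ?_⟩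
  · rintro V _ _ H _ n m q rfl rfl hH hq
    obtain ⟨h1, h2, h3, -⟩ := divSubdivNumber_bounds H hH q (by omega)
    refine ⟨h1, h2, h3.trans ?_⟩
    nlinarith [Nat.zero_le (q * H.edgeFinset.card)]
  · rintro V _ _ H _ n m q rfl rfl hH hq
    obtain ⟨-, h2, h3, h4⟩ := divSubdivNumber_bounds H hH q (by omega)
    generalize H.edgeFinset.card = m at *
    generalize Fintype.card V = n at *
    obtain ⟨k, rfl⟩ : ∃ k, q = k + 2 := ⟨q - 2, by omega⟩
    constructor
    · have h2' : ((m * (k + 2 - 1) + n : ℕ) : ℝ) ≤ divSubdivNumber H (k + 2) := by exact_mod_cast h2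
      rw [show k + 2 - 1 = k + 1 by omega] at h2'
      push_cast at h2' ⊢
      have : (0 : ℝ) ≤ m * k := by positivity
      have : (0 : ℝ) ≤ n := by positivity
      linarith
    · rcases Nat.eq_zero_or_pos m with rfl | hm
      · have h4' : ((divSubdivNumber H (k + 2) : ℕ) : ℝ) ≤ n := by exact_mod_cast h4 rfl
        have : (0 : ℝ) ≤ n := by positivity
        push_cast
        linarith
      · have h5 : divSubdivNumber H (k + 2) ≤ 15 * (m * (k + 2) + n) := by nlinarith
        exact_mod_cast h5
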